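/- Let $q\ge 1$ and $k\ge 1$ be integers, let $\mathbb U$ be the complex unit circle and let $\mathbb U_q\subset\mathbb U$ be the set of $q$-th roots of unity. Let $(X_n)_{n\ge 1}$ be a random completely multiplicative function, i.e. a family of $\mathbb U$-valued random variables on a probability space with $X_{mn}=X_mX_n$ for all $m,n\ge 1$, such that the variables $(X_p)_{p\text{ prime}}$ are independent and each uniformly distributed on $\mathbb U_q$. For $N\ge 1$ let $$\mu_{k,N}=\frac1N\sum_{n=1}^N\delta_{(X_{n+1},\dots,X_{n+k})}$$ be the (random) empirical measure on $\mathbb U^k$, and let $\mu_{k,q}$ be the uniform distribution on the finite set $\mathbb U_q^k$. Then, almost surely, $\mu_{k,N}$ converges weakly to $\mu_{k,q}$ as $N\to\infty$. More precisely, almost surely, for all $(t_1,\dots,t_k)\in\mathbb U_q^k$ and all $\varepsilon>0$, $$\frac1N\,\#\{1\le n\le N:\ (X_{n+1},\dots,X_{n+k})=(t_1,\dots,t_k)\}=q^{-k}+O\!\left(N^{-1/2+\varepsilon}\right)\qquad(N\to\infty),$$ where the implied constant may depend on the realization of $(X_n)$ and on $q,k,\varepsilon$. In particular, if $q=2$,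 then almost surely, for all $(t_1,\dots,t_k)\in\{-1,1\}^k$, the set of $n\ge 1$ with $(X_{n+1},\dots,X_{n+k})=(t_1,\dots,t_k)$ has asymptotic density $2^{-k}$ (the almost-sure analogue of Chowla's conjecture). -/

import Mathlib

open MeasureTheory ProbabilityTheory Filter Topology Asymptotics
open scoped ENNReal

/-- The unit circle carries its Borel `σ`-algebra. -/
noncomputable instance instMeasurableSpaceCircle : MeasurableSpace Circle := borel Circle

instance instBorelSpaceCircle : BorelSpace Circle := ⟨rfl⟩

/-- The set of `q`-th roots of unity on the unit circle. -/
def unityRoots (q : ℕ) : Set Circle := {z | z ^ q = 1}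

/-- The set of `k`-tuples of `q`-th roots of unity. -/
def unityRootsPow (q k : ℕ) : Set (Fin k → Circle) := {z | ∀ j, z j ∈ unityRoots q}

/-- Complete multiplicativity of a function on the positive integers (its value at `0` plays no
role). -/
structure IsCompletelyMultiplicative (f : ℕ → Circle) : Prop where
  map_one : f 1 = 1
  map_mul : ∀ m n : ℕ, 0 < m → 0 < n → f (m * n) = f m * f n

/-- The `k`-tuple `(f (n + 1), …, f (n + k))`. -/
def consecutiveValues (f : ℕ → Circle) (k n : ℕ) : Fin k → Circle :=
  fun j => f (n + ((j : ℕ) + 1))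

open Classical in
/-- The proportion of the integers `1 ≤ n ≤ N` with `(f (n + 1), …, f (n + k)) = t`. -/
noncomputable def patternProportion (f : ℕ → Circle) {k : ℕ} (t : Fin k → Circle) (N : ℕ) : ℝ :=
  (((Finset.Icc 1 N).filter fun n => consecutiveValues f k n = t).card : ℝ) / (N : ℝ)

/-- The empirical measure `N⁻¹ ∑_{n = 1}^N δ_{(f (n + 1), …, f (n + k))}`. -/
noncomputable def empiricalMeasure (f : ℕ → Circle) (k : ℕ) (N : ℕ+) :
    ProbabilityMeasure (Fin k → Circle) :=
  ⟨(((N : ℕ) : ℝ≥0∞))⁻¹ • ∑ n ∈ Finset.Icc 1 (N : ℕ), Measure.dirac (consecutiveValues f k n), by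
    constructor
    simp only [Measure.smul_apply, Measure.finsetSum_apply, measure_univ, Finset.sum_const,
      Nat.card_Icc, smul_eq_mul, nsmul_eq_mul, mul_one, Nat.add_sub_cancel]
    exact ENNReal.inv_mul_cancel (by simp) (by simp)⟩

theorem unityRoots_finite {q : ℕ} (hq : 0 < q) : (unityRoots q).Finite := by
  have h : ((fun z : Circle => (z : ℂ)) '' unityRoots q).Finite := by
    refine (Polynomial.nthRoots q (1 : ℂ)).toFinset.finite_toSet.subset ?_
    rintro _ ⟨z, hz, rfl⟩
    have hz' : z ^ q = 1 := hz
    simp only [Finset.mem_coe, Multiset.mem_toFinset, Polynomial.mem_nthRoots hq]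
    rw [← Circle.coe_pow, hz', Circle.coe_one]
  exact h.of_finite_image Subtype.val_injective.injOn

theorem unityRootsPow_finite {q : ℕ} (hq : 0 < q) (k : ℕ) : (unityRootsPow q k).Finite :=
  Set.Finite.pi' fun _ => unityRoots_finite hq

theorem unityRootsPow_nonempty (q k : ℕ) : (unityRootsPow q k).Nonempty :=
  ⟨1, fun _ => by simp [unityRoots]⟩

/-- The uniform distribution on the set of `k`-tuples of `q`-th roots of unity. -/
noncomputable def uniformRootsMeasure (q : ℕ) (hq : 0 < q) (k : ℕ) :
    ProbabilityMeasure (Fin k → Circle) :=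
  ⟨uniformOn (unityRootsPow q k),
    isProbabilityMeasure_uniformOn (unityRootsPow_finite hq k) (unityRootsPow_nonempty q k)⟩

/-!
The proof is a second moment computation followed by a maximal inequality.

By Fourier analysis on `U_q ^ k` (`patternProportion_eq_sum`), the proportion of the pattern `t`
minus `q ^ (-k)` is a combination of the averages over `n ≤ N` of the nontrivial characters
`∏ X_{n+j} ^ m_j = X_{M(n)}`, where `M(n) = ∏ (n + j) ^ m_j` is `shiftedProduct m n`. It suffices
to bound each of these character sums by `O(N ^ (1/2 + ε))` almost surely.

Since the `X_p` are independent and uniform on `U_q`, the variables `X_{M(n)}` and `X_{M(n')}` are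
orthogonal unless `M(n)` and `M(n')` have the same `q`-th-power-free part
(`integral_mul_conj_eq_zero`). So the second moment of a character sum over an interval is at most
the number of pairs `(n, n')` in it with this property, and the arithmetic input is that an interval
of length `L` below `H` contains only `O(L H ^ ε)` such pairs
(`exists_card_pairs_shiftedProduct_le`). Choose `i` with `q ∤ m_i`, and let
`r = q / gcd(q, m_i) ≥ 2`. A prime larger than `k` divides at most one of the factors of `M(n)`, so
the power-free part of `M(n)` leaves only `O(H ^ ε)` possibilities, by the divisor bound, for the
`r`-th-power-free part `a` of `n + i`. If `n + i = a x ^ r` and `n' + i = a y ^ r` with `x < y`,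
then `a` and `y - x` are divisors of `n' - n < L`, and together with `n' - n` they determine the
pair; the divisor bound applies once more.

Finally, the Rademacher–Menshov inequality (`norm_sq_sum_le_mul_dyadicSquareSum`) bounds all partial
sums up to `2 ^ J` by the sum of the squares of the character sums over dyadic blocks. The
expectation of the latter is `O(2 ^ (J (1 + ε)))`, up to a polynomial in `J`, so summing over `J`
gives the almost sure bound (`ae_exists_norm_sum_le_rpow`).
-/

/-! ### The divisor bound -/

/-- One constant bounds the local factor of the divisor function at every prime, by Bernoulli's
inequality. -/
theorem exists_natCast_add_one_le_mul_rpow {ε : ℝ} (hε : 0 < ε) :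
    ∃ A : ℝ, 1 ≤ A ∧ ∀ (p v : ℕ), 2 ≤ p → (v : ℝ) + 1 ≤ A * (p : ℝ) ^ (ε * v) := by
  set δ : ℝ := 2 ^ ε - 1 with hδ
  have hδ0 : 0 < δ := by
    have := Real.one_lt_rpow (x := 2) (by norm_num) hε
    linarith
  refine ⟨1 + δ⁻¹, by have := inv_pos.2 hδ0; linarith, fun p v hp => ?_⟩
  have h1 : 1 + (v : ℝ) * δ ≤ (1 + δ) ^ v := one_add_mul_le_pow (by linarith) v
  have h2 : (1 + δ) ^ v ≤ (p : ℝ) ^ (ε * v) := by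
    rw [Real.rpow_mul (by positivity), Real.rpow_natCast]
    have : (1 + δ) = 2 ^ ε := by rw [hδ]; ring
    rw [this]
    gcongr
    exact_mod_cast hp
  calc (v : ℝ) + 1 ≤ (1 + δ⁻¹) * (1 + v * δ) := by
        have : (1 + δ⁻¹) * (1 + v * δ) = 1 + v * δ + δ⁻¹ + v * (δ⁻¹ * δ) := by ring
        rw [this, inv_mul_cancel₀ hδ0.ne']
        have : 0 ≤ (v : ℝ) * δ + δ⁻¹ := by positivity
        linarith
    _ ≤ (1 + δ⁻¹) * (p : ℝ) ^ (ε * v) := by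
        have := inv_pos.2 hδ0
        gcongr
        exact h1.trans h2

/-- The divisor bound: the number of divisors of `n` is `O(n ^ ε)`. In the product of the local
factors `v + 1`, a prime with `2 ≤ p ^ ε` costs nothing, and each of the finitely many other primes
costs a constant. -/
theorem exists_card_divisors_le_mul_rpow {ε : ℝ} (hε : 0 < ε) :
    ∃ K : ℝ, 0 < K ∧ ∀ n : ℕ, n ≠ 0 → (n.divisors.card : ℝ) ≤ K * (n : ℝ) ^ ε := by
  obtain ⟨A, hA, hAv⟩ := exists_natCast_add_one_le_mul_rpow hε
  obtain ⟨T, hT⟩ := exists_nat_ge ((2 : ℝ) ^ ε⁻¹)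
  have hlarge : ∀ p v : ℕ, T ≤ p → (v : ℝ) + 1 ≤ (p : ℝ) ^ (ε * v) := by
    intro p v hp
    have hp' : (2 : ℝ) ^ ε⁻¹ ≤ p := hT.trans (by exact_mod_cast hp)
    have h2 : (2 : ℝ) ≤ (p : ℝ) ^ ε := by
      calc (2 : ℝ) = ((2 : ℝ) ^ ε⁻¹) ^ ε := by
            rw [← Real.rpow_mul (by norm_num), inv_mul_cancel₀ hε.ne', Real.rpow_one]
        _ ≤ (p : ℝ) ^ ε := by gcongr
    rw [Real.rpow_mul (by positivity), Real.rpow_natCast]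
    calc (v : ℝ) + 1 ≤ (2 : ℝ) ^ v := by exact_mod_cast Nat.lt_two_pow_self (n := v)
      _ ≤ _ := by gcongr
  refine ⟨A ^ T, by positivity, fun n hn => ?_⟩
  rw [Nat.card_divisors hn]
  push_cast
  have hprod : (∏ p ∈ n.primeFactors, (p : ℝ) ^ (ε * (n.factorization p : ℝ))) = (n : ℝ) ^ ε := by
    have h' : (n : ℝ) = ∏ p ∈ n.primeFactors, (p : ℝ) ^ (n.factorization p) := by
      conv_lhs => rw [← Nat.prod_factorization_pow_eq_self hn]
      rw [Finsupp.prod, Nat.support_factorization]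
      push_cast
      rfl
    conv_rhs => rw [h']
    rw [← Real.finsetProd_rpow _ _ (fun p _ => by positivity)]
    refine Finset.prod_congr rfl fun p _ => ?_
    rw [mul_comm, Real.rpow_mul (by positivity), Real.rpow_natCast]
  calc ∏ p ∈ n.primeFactors, ((n.factorization p : ℝ) + 1)
      ≤ ∏ p ∈ n.primeFactors, ((if p < T then A else 1) *
          (p : ℝ) ^ (ε * (n.factorization p : ℝ))) := by
        refine Finset.prod_le_prod (fun p _ => by positivity) fun p hp => ?_
        split_ifs with h
        · exact hAv p _ (Nat.prime_of_mem_primeFactors hp).two_le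
        · rw [one_mul]; exact hlarge p _ (not_lt.1 h)
    _ = A ^ (n.primeFactors.filter (· < T)).card * (n : ℝ) ^ ε := by
        rw [Finset.prod_mul_distrib, hprod, ← Finset.prod_filter, Finset.prod_const]
    _ ≤ A ^ T * (n : ℝ) ^ ε := by
        gcongr
        calc _ ≤ (Finset.range T).card := Finset.card_le_card fun p hp => by
              simp only [Finset.mem_filter] at hp
              simpa using hp.2
          _ = T := Finset.card_range T

/-! ### The power-free part of an integer -/

/-- The `r`-th-power-free part `∏ p ^ (v_p(n) mod r)` of `n` (equal to `1` for `n = 0`). -/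
noncomputable def powerFreePart (r n : ℕ) : ℕ :=
  (n.factorization.mapRange (· % r) (Nat.zero_mod r)).prod (· ^ ·)

theorem factorization_powerFreePart (r n p : ℕ) :
    (powerFreePart r n).factorization p = n.factorization p % r := by
  rw [powerFreePart, Nat.prod_pow_factorization_eq_self]
  · simp
  · intro p hp
    have : n.factorization p ≠ 0 := by
      intro h; simp [h] at hp
    exact Nat.prime_of_mem_primeFactors (by simpa [← Nat.support_factorization] using this)

theorem powerFreePart_ne_zero (r n : ℕ) : powerFreePart r n ≠ 0 := by
  rw [powerFreePart, Finsupp.prod, Finset.prod_ne_zero_iff]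
  intro p hp
  have : n.factorization p ≠ 0 := by
    intro h; simp [h] at hp
  have hp' : p ∈ n.primeFactors := by rwa [← Nat.support_factorization, Finsupp.mem_support_iff]
  exact pow_ne_zero _ (Nat.prime_of_mem_primeFactors hp').ne_zero

theorem powerFreePart_eq_iff {r n n' : ℕ} :
    powerFreePart r n = powerFreePart r n' ↔
      ∀ p, n.factorization p % r = n'.factorization p % r := by
  constructor
  · intro h p
    rw [← factorization_powerFreePart, h, factorization_powerFreePart]
  · intro h
    refine Nat.eq_of_factorization_eq (powerFreePart_ne_zero _ _) (powerFreePart_ne_zero _ _) ?_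
    intro p
    rw [factorization_powerFreePart, factorization_powerFreePart, h]

theorem powerFreePart_dvd (r : ℕ) {n : ℕ} (hn : n ≠ 0) : powerFreePart r n ∣ n := by
  rw [← Nat.factorization_le_iff_dvd (powerFreePart_ne_zero _ _) hn]
  intro p
  rw [factorization_powerFreePart]
  exact Nat.mod_le _ _

theorem exists_eq_powerFreePart_mul_pow (r : ℕ) {n : ℕ} (hn : n ≠ 0) :
    ∃ x, n = powerFreePart r n * x ^ r := by
  set f : ℕ →₀ ℕ := n.factorization.mapRange (· / r) (Nat.zero_div r) with hf
  have hsupp : ∀ p ∈ f.support, p.Prime := by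
    intro p hp
    have : n.factorization p ≠ 0 := by
      intro h; simp [hf, h] at hp
    have hp' : p ∈ n.primeFactors := by rwa [← Nat.support_factorization, Finsupp.mem_support_iff]
    exact Nat.prime_of_mem_primeFactors hp'
  have hx0 : f.prod (· ^ ·) ≠ 0 := by
    rw [Finsupp.prod, Finset.prod_ne_zero_iff]
    exact fun p hp => pow_ne_zero _ (hsupp p hp).ne_zero
  refine ⟨f.prod (· ^ ·), ?_⟩
  refine Nat.eq_of_factorization_eq hn (mul_ne_zero (powerFreePart_ne_zero _ _)
    (pow_ne_zero _ hx0)) fun p => ?_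
  rw [Nat.factorization_mul (powerFreePart_ne_zero _ _) (pow_ne_zero _ hx0),
    Finsupp.add_apply, factorization_powerFreePart, Nat.factorization_pow,
    Nat.prod_pow_factorization_eq_self hsupp]
  simp [hf, Nat.mod_add_div]

/-! ### Pairs of integers in a short interval with equal power-free parts -/

theorem strictMono_add_pow_sub_pow {d r : ℕ} (hd : 0 < d) (hr : 2 ≤ r) :
    StrictMono fun x : ℕ => ((x + d : ℕ) : ℤ) ^ r - (x : ℤ) ^ r := by
  refine strictMono_nat_of_lt_succ fun x => ?_
  obtain ⟨r, rfl⟩ : ∃ t, r = t + 1 := ⟨r - 1, by omega⟩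
  induction r with
  | zero => omega
  | succ t ih =>
    rcases Nat.eq_zero_or_pos t with rfl | ht
    · push_cast; nlinarith
    · have h1 := ih (by omega)
      have h2 : ((x + d : ℕ) : ℤ) ^ (t + 1) < ((x + 1 + d : ℕ) : ℤ) ^ (t + 1) := by
        gcongr; omega
      have h3 : (0 : ℤ) ≤ ((x + d : ℕ) : ℤ) ^ (t + 1) - (x : ℤ) ^ (t + 1) := by
        rw [sub_nonneg]; gcongr; omega
      simp only [pow_succ _ (t + 1)]
      push_cast at *
      set u := ((x : ℤ) + d) ^ (t + 1)
      set w := (x : ℤ) ^ (t + 1)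
      set u' := ((x : ℤ) + 1 + d) ^ (t + 1)
      set w' := ((x : ℤ) + 1) ^ (t + 1)
      have hd' : (0 : ℤ) < d := by exact_mod_cast hd
      have hx : (0 : ℤ) ≤ x := by positivity
      nlinarith [mul_nonneg hx (sub_nonneg.2 h1.le), mul_pos hd' (sub_pos.2 h2)]

/-- Integers `y < z` with the same `r`-th-power-free part `a` and a given difference `l` are
determined by two divisors of `l`: writing `y = a x ^ r` and `z = a (x + d) ^ r`, both `a` and `d`
divide `l = a ((x + d) ^ r - x ^ r)`, and they determine `x`. -/
theorem card_pairs_powerFreePart_eq_sub_eq_le (r s L i l : ℕ) (hr : 2 ≤ r) (hi : 0 < i)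
    (hl : 0 < l) :
    ((Finset.Ico s (s + L) ×ˢ Finset.Ico s (s + L)).filter fun z : ℕ × ℕ =>
      powerFreePart r (z.1 + i) = powerFreePart r (z.2 + i) ∧ z.2 = z.1 + l).card
      ≤ l.divisors.card ^ 2 := by
  choose x hx using fun n : ℕ => exists_eq_powerFreePart_mul_pow r (n := n + i) (by omega)
  have key : ∀ n n' : ℕ, powerFreePart r (n + i) = powerFreePart r (n' + i) → n' = n + l →
      x n < x n' ∧ l = powerFreePart r (n + i) * (x n' ^ r - x n ^ r) := by
    intro n n' h hl'
    have h1 := hx n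
    have h2 := hx n'
    rw [← h] at h2
    have hlt : x n < x n' := by
      by_contra hcon
      have : x n' ^ r ≤ x n ^ r := Nat.pow_le_pow_left (not_lt.1 hcon) r
      have := Nat.mul_le_mul_left (powerFreePart r (n + i)) this
      omega
    refine ⟨hlt, ?_⟩
    rw [Nat.mul_sub, ← h1, ← h2]
    omega
  rw [sq, ← Finset.card_product]
  refine Finset.card_le_card_of_injOn
    (fun z => (powerFreePart r (z.1 + i), x z.2 - x z.1)) ?_ ?_
  · rintro ⟨n, n'⟩ hz
    simp only [Finset.coe_filter, Set.mem_ofPred_eq] at hz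
    obtain ⟨hlt, hl'⟩ := key n n' hz.2.1 hz.2.2
    simp only [Finset.coe_product, Set.mem_prod, Finset.mem_coe, Nat.mem_divisors]
    refine ⟨⟨⟨_, hl'⟩, hl.ne'⟩, ?_, hl.ne'⟩
    rw [hl']
    exact (Nat.sub_dvd_pow_sub_pow _ _ _).mul_left _
  · rintro ⟨n, n'⟩ hz ⟨y, y'⟩ hw heq
    simp only [Finset.coe_filter, Set.mem_ofPred_eq] at hz hw
    simp only [Prod.mk.injEq] at heq
    obtain ⟨hlt, h1⟩ := key n n' hz.2.1 hz.2.2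
    obtain ⟨hlt', h2⟩ := key y y' hw.2.1 hw.2.2
    obtain ⟨ha, hd⟩ := heq
    have hx' : x n' = x n + (x n' - x n) := by omega
    have hy' : x y' = x y + (x n' - x n) := by omega
    have hpos : 0 < x n' - x n := by omega
    set d := x n' - x n
    have e : x n' ^ r - x n ^ r = x y' ^ r - x y ^ r := by
      rw [← ha] at h2
      exact Nat.eq_of_mul_eq_mul_left (Nat.pos_of_ne_zero (powerFreePart_ne_zero r (n + i)))
        (h1.symm.trans h2)
    have hxy : x n = x y := by
      refine (strictMono_add_pow_sub_pow hpos hr).injective ?_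
      have l1 : x n ^ r ≤ x n' ^ r := by gcongr
      have l2 : x y ^ r ≤ x y' ^ r := by gcongr
      simp only [← hx', ← hy']
      zify [l1, l2] at e
      exact e
    have hn : n + i = y + i := by rw [hx n, hx y, ha, hxy]
    have : n = y := by omega
    simp only [Prod.mk.injEq]
    omega

theorem card_pairs_powerFreePart_eq_le (r s L i D : ℕ) (hr : 2 ≤ r) (hi : 0 < i)
    (hD : ∀ l, 0 < l → l < L → l.divisors.card ≤ D) :
    ((Finset.Ico s (s + L) ×ˢ Finset.Ico s (s + L)).filter fun z : ℕ × ℕ =>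
      powerFreePart r (z.1 + i) = powerFreePart r (z.2 + i)).card ≤ (1 + 2 * D ^ 2) * L := by
  set S := (Finset.Ico s (s + L) ×ˢ Finset.Ico s (s + L)).filter fun z : ℕ × ℕ =>
      powerFreePart r (z.1 + i) = powerFreePart r (z.2 + i) with hS
  have hlt : (S.filter fun z => z.1 < z.2).card ≤ D ^ 2 * L := by
    calc _ ≤ D ^ 2 * (Finset.Ico 1 L).card := by
          refine Finset.card_le_mul_card_image_of_maps_to (f := fun z : ℕ × ℕ => z.2 - z.1) ?_ _ ?_
          · rintro ⟨n, n'⟩ h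
            simp only [hS, Finset.mem_filter, Finset.mem_product, Finset.mem_Ico] at h ⊢
            omega
          · intro l hl
            rw [Finset.mem_Ico] at hl
            refine le_trans (Finset.card_le_card ?_)
              ((card_pairs_powerFreePart_eq_sub_eq_le r s L i l hr hi hl.1).trans
                (Nat.pow_le_pow_left (hD l hl.1 hl.2) 2))
            rintro ⟨n, n'⟩ h
            simp only [hS, Finset.mem_filter] at h ⊢
            exact ⟨h.1.1.1, h.1.1.2, by omega⟩
      _ ≤ D ^ 2 * L := by gcongr; simp
  have hgt : (S.filter fun z => z.2 < z.1).card ≤ D ^ 2 * L := by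
    refine le_trans (Finset.card_le_card_of_injOn Prod.swap ?_ Prod.swap_injective.injOn) hlt
    rintro ⟨n, n'⟩ h
    simp only [hS, Finset.mem_filter, Finset.coe_filter, Set.mem_ofPred_eq,
      Finset.mem_product, Prod.swap] at h ⊢
    exact ⟨⟨⟨h.1.1.2, h.1.1.1⟩, h.1.2.symm⟩, h.2⟩
  have heq : (S.filter fun z => z.1 = z.2).card ≤ L := by
    calc _ ≤ (Finset.Ico s (s + L)).card := by
          refine Finset.card_le_card_of_injOn Prod.fst ?_ ?_
          · rintro ⟨n, n'⟩ h
            simp only [hS, Finset.coe_filter, Set.mem_ofPred_eq, Finset.mem_filter,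
              Finset.mem_product] at h
            exact h.1.1.1
          · rintro ⟨n, n'⟩ h ⟨y, y'⟩ h' e
            simp only [Finset.coe_filter, Set.mem_ofPred_eq] at h h' e
            simp only [Prod.mk.injEq]
            omega
      _ = L := by simp
  have hsub : S ⊆ (S.filter fun z => z.1 = z.2) ∪
      ((S.filter fun z => z.1 < z.2) ∪ (S.filter fun z => z.2 < z.1)) := by
    intro z hz
    simp only [Finset.mem_union, Finset.mem_filter, hz, true_and]
    omega
  calc S.card ≤ _ := Finset.card_le_card hsub
    _ ≤ _ := Finset.card_union_le _ _
    _ ≤ _ := Nat.add_le_add_left (Finset.card_union_le _ _) _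
    _ ≤ (1 + 2 * D ^ 2) * L := by linarith

/-- If a map `g` takes at most `D` values on each fibre of `f`, then the pairs on which `f` agrees
are at most `D` times as many as the pairs on which `g` agrees, by the Cauchy–Schwarz inequality on
each fibre of `f`. -/
theorem card_pairs_eq_le_mul {ι α β : Type*} [DecidableEq ι] [DecidableEq α] [DecidableEq β]
    (I : Finset ι) (f : ι → α) (g : ι → β) (A : α → Finset β) (D : ℕ)
    (hg : ∀ n ∈ I, g n ∈ A (f n)) (hA : ∀ n ∈ I, (A (f n)).card ≤ D) :
    ((I ×ˢ I).filter fun z => f z.1 = f z.2).card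
      ≤ D * ((I ×ˢ I).filter fun z => g z.1 = g z.2).card := by
  have hfib : ∀ c, ((((I ×ˢ I).filter fun z => f z.1 = f z.2).filter fun z => f z.1 = c).card)
      = (I.filter fun n => f n = c).card ^ 2 := by
    intro c
    rw [sq, ← Finset.card_product]
    congr 1
    ext ⟨n, n'⟩
    simp only [Finset.mem_filter, Finset.mem_product]
    grind
  have hfib2 : ∀ c a, ((((I ×ˢ I).filter fun z => g z.1 = g z.2).filter
      fun z => f z.1 = c ∧ f z.2 = c ∧ g z.1 = a).card)
      = (I.filter fun n => f n = c ∧ g n = a).card ^ 2 := by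
    intro c a
    rw [sq, ← Finset.card_product]
    congr 1
    ext ⟨n, n'⟩
    simp only [Finset.mem_filter, Finset.mem_product]
    grind
  have hstep : ∀ c ∈ I.image f, (I.filter fun n => f n = c).card ^ 2 ≤
      D * (((I ×ˢ I).filter fun z => g z.1 = g z.2).filter
        fun z => f z.1 = c).card := by
    intro c hc
    obtain ⟨n₀, hn₀, rfl⟩ := Finset.mem_image.1 hc
    have h1 : (I.filter fun n => f n = f n₀).card
        = ∑ a ∈ A (f n₀), (I.filter fun n => f n = f n₀ ∧ g n = a).card := by
      rw [Finset.card_eq_sum_card_fiberwise (f := g) (t := A (f n₀))]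
      · simp only [Finset.filter_filter]
      · intro n hn
        simp only [Finset.coe_filter, Set.mem_ofPred_eq] at hn
        rw [← hn.2]
        exact hg n hn.1
    have h2 : ∑ a ∈ A (f n₀), (I.filter fun n => f n = f n₀ ∧ g n = a).card ^ 2
        ≤ (((I ×ˢ I).filter fun z => g z.1 = g z.2).filter fun z => f z.1 = f n₀).card := by
      simp only [← hfib2]
      rw [← Finset.card_biUnion]
      · refine Finset.card_le_card ?_
        intro z
        simp only [Finset.mem_biUnion, Finset.mem_filter]
        rintro ⟨a, _, h, h'⟩
        exact ⟨h, h'.1⟩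
      · intro a _ b _ hab
        rw [Function.onFun, Finset.disjoint_left]
        intro z hz hz'
        simp only [Finset.mem_filter] at hz hz'
        exact hab (hz.2.2.2.symm.trans hz'.2.2.2)
    calc (I.filter fun n => f n = f n₀).card ^ 2
        ≤ (A (f n₀)).card * ∑ a ∈ A (f n₀), (I.filter fun n => f n = f n₀ ∧ g n = a).card ^ 2 := by
          rw [h1]; exact sq_sum_le_card_mul_sum_sq
      _ ≤ _ := Nat.mul_le_mul (hA n₀ hn₀) h2
  have himg : ∀ (S : Finset (ι × ι)), S ⊆ I ×ˢ I →
      S.card = ∑ c ∈ I.image f, (S.filter fun z => f z.1 = c).card := by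
    intro S hS
    refine Finset.card_eq_sum_card_fiberwise (f := fun z : ι × ι => f z.1) (t := I.image f) ?_
    intro z hz
    exact Finset.mem_image_of_mem _ (Finset.mem_product.1 (hS hz)).1
  rw [himg _ (Finset.filter_subset _ _),
    himg ((I ×ˢ I).filter fun z => g z.1 = g z.2) (Finset.filter_subset _ _), Finset.mul_sum]
  refine Finset.sum_le_sum fun c hc => ?_
  rw [hfib]
  exact hstep c hc

/-! ### Products of consecutive integers -/

/-- The product `(n + 1) ^ m₀ ⋯ (n + k) ^ m_{k-1}`. -/
def shiftedProduct {k : ℕ} (m : Fin k → ℕ) (n : ℕ) : ℕ :=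
  ∏ j : Fin k, (n + ((j : ℕ) + 1)) ^ m j

theorem shiftedProduct_ne_zero {k : ℕ} (m : Fin k → ℕ) (n : ℕ) : shiftedProduct m n ≠ 0 :=
  Finset.prod_ne_zero_iff.2 fun _ _ => pow_ne_zero _ (by omega)

theorem factorization_shiftedProduct {k : ℕ} (m : Fin k → ℕ) (n p : ℕ) :
    (shiftedProduct m n).factorization p
      = ∑ j : Fin k, m j * (n + ((j : ℕ) + 1)).factorization p := by
  rw [shiftedProduct, Nat.factorization_prod fun _ _ => pow_ne_zero _ (by omega)]
  simp [Finsupp.finsetSum_apply]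

theorem shiftedProduct_le {k : ℕ} (m : Fin k → ℕ) {n H : ℕ} (h : n + k ≤ H) :
    shiftedProduct m n ≤ H ^ ∑ j, m j := by
  rw [shiftedProduct, ← Finset.prod_pow_eq_pow_sum]
  exact Finset.prod_le_prod' fun j _ => Nat.pow_le_pow_left (by omega) _

/-- A prime larger than `k` divides at most one of `n + 1, …, n + k`, so a prime of the power-free
part of `n + i + 1` is at most `k` or survives in the power-free part of the product. -/
theorem powerFreePart_dvd_pow_of_shiftedProduct {q k : ℕ} (hq : 0 < q) (m : Fin k → ℕ) (i : Fin k)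
    (n : ℕ) :
    powerFreePart (q / q.gcd (m i)) (n + ((i : ℕ) + 1)) ∣
      (powerFreePart q (shiftedProduct m n) * k.factorial) ^ q := by
  set r := q / q.gcd (m i) with hr
  have hb0 : powerFreePart q (shiftedProduct m n) * k.factorial ≠ 0 :=
    mul_ne_zero (powerFreePart_ne_zero _ _) k.factorial_ne_zero
  rw [← Nat.factorization_prime_le_iff_dvd (powerFreePart_ne_zero _ _) (pow_ne_zero _ hb0)]
  intro p hp
  rw [factorization_powerFreePart, Nat.factorization_pow,
    Nat.factorization_mul (powerFreePart_ne_zero _ _) k.factorial_ne_zero]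
  simp only [Finsupp.smul_apply, Finsupp.add_apply, smul_eq_mul, factorization_powerFreePart]
  set v := (n + ((i : ℕ) + 1)).factorization p with hv
  rcases Nat.eq_zero_or_pos (v % r) with h0 | hpos
  · rw [h0]; exact Nat.zero_le _
  have hr0 : 0 < r := Nat.div_pos (Nat.gcd_le_left _ hq) (Nat.gcd_pos_of_pos_left _ hq)
  have hvr : v % r ≤ q := (Nat.mod_lt _ hr0).le.trans (Nat.div_le_self _ _)
  refine hvr.trans (Nat.le_mul_of_pos_right q ?_)
  rcases le_or_gt p k with hpk | hpk
  · have := (hp.factorization_pos_of_dvd k.factorial_ne_zero (Nat.dvd_factorial hp.pos hpk))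
    omega
  · refine Nat.add_pos_left (Nat.pos_of_ne_zero fun hcon => ?_) _
    rw [factorization_shiftedProduct, Finset.sum_eq_single i, ← hv] at hcon
    · have h1 : q ∣ m i * v := Nat.dvd_of_mod_eq_zero hcon
      have h2 : r ∣ (m i / q.gcd (m i)) * v := by
        have hg := Nat.gcd_pos_of_pos_left (m i) hq
        refine Nat.dvd_of_mul_dvd_mul_left hg ?_
        rwa [hr, Nat.mul_div_cancel' (Nat.gcd_dvd_left _ _), ← mul_assoc,
          Nat.mul_div_cancel' (Nat.gcd_dvd_right _ _)]
      have h3 : r.Coprime (m i / q.gcd (m i)) :=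
        Nat.coprime_div_gcd_div_gcd (Nat.gcd_pos_of_pos_left _ hq)
      have := Nat.mod_eq_zero_of_dvd (h3.dvd_of_dvd_mul_left h2)
      omega
    · intro j _ hji
      suffices (n + ((j : ℕ) + 1)).factorization p = 0 by rw [this, mul_zero]
      refine Nat.factorization_eq_zero_of_not_dvd fun hdj => hji ?_
      have hdi : p ∣ n + ((i : ℕ) + 1) := by
        by_contra hnd
        rw [hv, Nat.factorization_eq_zero_of_not_dvd hnd] at hpos
        simp at hpos
      have hmod : (n + ((j : ℕ) + 1)) ≡ (n + ((i : ℕ) + 1)) [MOD p] :=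
        ((Nat.modEq_zero_iff_dvd.2 hdj).trans (Nat.modEq_zero_iff_dvd.2 hdi).symm)
      have hmod' : (j : ℕ) + 1 ≡ (i : ℕ) + 1 [MOD p] := Nat.ModEq.add_left_cancel' n hmod
      have hmod'' : (j : ℕ) ≡ (i : ℕ) [MOD p] := Nat.ModEq.add_right_cancel' 1 hmod'
      exact Fin.ext (hmod''.eq_of_lt_of_lt (j.2.trans hpk) (i.2.trans hpk))
    · simp

/-- The number of pairs in an interval of length `L` below `H` at which the products
`∏ (n + j + 1) ^ m_j` agree up to `q`-th powers is `O(L H ^ ε)`. -/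
theorem exists_card_pairs_shiftedProduct_le {q k : ℕ} (hq : 0 < q) (m : Fin k → ℕ) (i : Fin k)
    (hm : ¬ q ∣ m i) {ε : ℝ} (hε : 0 < ε) :
    ∃ K : ℝ, 0 < K ∧ ∀ s L H : ℕ, s + L + k ≤ H →
      (((Finset.Ico s (s + L) ×ˢ Finset.Ico s (s + L)).filter fun z : ℕ × ℕ =>
        powerFreePart q (shiftedProduct m z.1) = powerFreePart q (shiftedProduct m z.2)).card : ℝ)
        ≤ K * (H : ℝ) ^ ε * L := by
  set A : ℕ := (∑ j, m j) * q with hA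
  -- the divisor bound is applied to integers up to `(H ^ A) * (k !) ^ q` with exponent `δ`
  set δ : ℝ := ε / (A + 2) with hδ
  have hδ0 : 0 < δ := by positivity
  obtain ⟨K, hK, hdiv⟩ := exists_card_divisors_le_mul_rpow hδ0
  set F : ℝ := (k.factorial : ℝ) ^ q
  have hF : 0 < F := by have := k.factorial_pos; positivity
  set r := q / q.gcd (m i) with hr
  have hr2 : 2 ≤ r := by
    have hg := Nat.gcd_pos_of_pos_left (m i) hq
    have h1 : 0 < r := Nat.div_pos (Nat.gcd_le_left _ hq) hg
    rcases Nat.lt_or_ge 1 r with h | h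
    · exact h
    · exfalso
      have h2 : r = 1 := by omega
      have h3 : q = q.gcd (m i) := by
        have := Nat.div_mul_cancel (Nat.gcd_dvd_left q (m i))
        rw [← hr, h2, one_mul] at this
        exact this.symm
      exact hm (h3 ▸ Nat.gcd_dvd_right q (m i))
  refine ⟨K * F ^ δ * (1 + 2 * K ^ 2), by positivity, fun s L H hH => ?_⟩
  rcases Nat.eq_zero_or_pos L with rfl | hL
  · simp
  have hH1 : (1 : ℝ) ≤ H := by exact_mod_cast (by omega : 1 ≤ H)
  set D₁ : ℕ := ⌊K * (H : ℝ) ^ δ⌋₊ with hD₁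
  set D₂ : ℕ := ⌊K * (F ^ δ * (H : ℝ) ^ (A * δ))⌋₊ with hD₂
  have hD : ∀ l, 0 < l → l < L → l.divisors.card ≤ D₁ := by
    intro l hl hlL
    refine Nat.le_floor ((hdiv l hl.ne').trans ?_)
    gcongr
    omega
  have hcls : ∀ n ∈ Finset.Ico s (s + L),
      ((powerFreePart q (shiftedProduct m n) * k.factorial) ^ q).divisors.card ≤ D₂ := by
    intro n hn
    rw [Finset.mem_Ico] at hn
    refine Nat.le_floor ((hdiv _ (pow_ne_zero _ (mul_ne_zero (powerFreePart_ne_zero _ _)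
      k.factorial_ne_zero))).trans ?_)
    gcongr
    rw [Real.rpow_mul (by positivity), ← Real.mul_rpow hF.le (by positivity)]
    refine Real.rpow_le_rpow (by positivity) ?_ hδ0.le
    rw [Real.rpow_natCast, hA, pow_mul, mul_comm, ← mul_pow]
    have : powerFreePart q (shiftedProduct m n) ≤ H ^ ∑ j, m j :=
      (Nat.le_of_dvd (Nat.pos_of_ne_zero (shiftedProduct_ne_zero m n))
        (powerFreePart_dvd q (shiftedProduct_ne_zero m n))).trans (shiftedProduct_le m (by omega))
    push_cast
    gcongr
    exact_mod_cast this
  have h1 := card_pairs_eq_le_mul (Finset.Ico s (s + L))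
    (fun n => powerFreePart q (shiftedProduct m n))
    (fun n => powerFreePart r (n + ((i : ℕ) + 1)))
    (fun c => ((c * k.factorial) ^ q).divisors) D₂
    (fun n _ => Nat.mem_divisors.2 ⟨powerFreePart_dvd_pow_of_shiftedProduct hq m i n,
      pow_ne_zero _ (mul_ne_zero (powerFreePart_ne_zero _ _) k.factorial_ne_zero)⟩) hcls
  have h2 := card_pairs_powerFreePart_eq_le r s L ((i : ℕ) + 1) D₁ hr2 (by omega) hD
  have h3 := h1.trans (Nat.mul_le_mul_left D₂ h2)
  have hD₁' : (D₁ : ℝ) ≤ K * (H : ℝ) ^ δ := Nat.floor_le (by positivity)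
  have hD₂' : (D₂ : ℝ) ≤ K * (F ^ δ * (H : ℝ) ^ (A * δ)) := Nat.floor_le (by positivity)
  have hHδ : (1 : ℝ) ≤ (H : ℝ) ^ δ := Real.one_le_rpow hH1 hδ0.le
  calc _ ≤ ((D₂ * ((1 + 2 * D₁ ^ 2) * L) : ℕ) : ℝ) := by exact_mod_cast h3
    _ = (D₂ : ℝ) * ((1 + 2 * (D₁ : ℝ) ^ 2) * L) := by push_cast; ring
    _ ≤ (K * (F ^ δ * (H : ℝ) ^ (A * δ))) *
          ((1 + 2 * (K * (H : ℝ) ^ δ) ^ 2) * L) := by gcongr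
    _ ≤ (K * (F ^ δ * (H : ℝ) ^ (A * δ))) *
          (((H : ℝ) ^ δ) ^ 2 * (1 + 2 * K ^ 2) * L) := by
        gcongr
        nlinarith [one_le_pow₀ hHδ (n := 2)]
    _ = K * F ^ δ * (1 + 2 * K ^ 2) * ((H : ℝ) ^ (A * δ) * ((H : ℝ) ^ δ) ^ 2) * L := by ring
    _ = K * F ^ δ * (1 + 2 * K ^ 2) * (H : ℝ) ^ ε * L := by
        congr 2
        rw [← Real.rpow_natCast, ← Real.rpow_mul (by positivity),
          ← Real.rpow_add (by positivity)]
        congr 1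
        rw [hδ]
        push_cast
        field_simp

/-! ### Second moments on dyadic blocks control all partial sums -/

/-- The sum of `‖∑ n ∈ B, f n‖ ^ 2` over all dyadic sub-blocks `B` of `[s, s + 2 ^ J)`. -/
noncomputable def dyadicSquareSum (f : ℕ → ℂ) : ℕ → ℕ → ℝ
  | 0, s => ‖∑ n ∈ Finset.Ico s (s + 2 ^ 0), f n‖ ^ 2
  | J + 1, s => ‖∑ n ∈ Finset.Ico s (s + 2 ^ (J + 1)), f n‖ ^ 2
      + (dyadicSquareSum f J s + dyadicSquareSum f J (s + 2 ^ J))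

theorem dyadicSquareSum_nonneg (f : ℕ → ℂ) (J s : ℕ) : 0 ≤ dyadicSquareSum f J s := by
  induction J generalizing s with
  | zero => rw [dyadicSquareSum]; positivity
  | succ J ih =>
    rw [dyadicSquareSum]
    have := ih s
    have := ih (s + 2 ^ J)
    positivity

theorem norm_sq_sum_le_dyadicSquareSum (f : ℕ → ℂ) (J s : ℕ) :
    ‖∑ n ∈ Finset.Ico s (s + 2 ^ J), f n‖ ^ 2 ≤ dyadicSquareSum f J s := by
  cases J with
  | zero => rw [dyadicSquareSum]
  | succ J =>
    rw [dyadicSquareSum]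
    have := dyadicSquareSum_nonneg f J s
    have := dyadicSquareSum_nonneg f J (s + 2 ^ J)
    linarith

theorem add_sq_le_mul_add_div {a b c : ℝ} (hc : 0 < c) :
    (a + b) ^ 2 ≤ (c + 1) * (a ^ 2 + b ^ 2 / c) := by
  have h : (c + 1) * (a ^ 2 + b ^ 2 / c) - (a + b) ^ 2 = (c * a - b) ^ 2 / c := by
    field_simp
    ring
  have : 0 ≤ (c * a - b) ^ 2 / c := by positivity
  linarith

/-- The Rademacher–Menshov inequality: an initial segment of a dyadic block of length `2 ^ J`
splits into at most `J + 1` dyadic blocks, to which the Cauchy–Schwarz inequality applies. -/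
theorem norm_sq_sum_le_mul_dyadicSquareSum (f : ℕ → ℂ) (J s M : ℕ) (hM : M ≤ 2 ^ J) :
    ‖∑ n ∈ Finset.Ico s (s + M), f n‖ ^ 2 ≤ (J + 1) * dyadicSquareSum f J s := by
  induction J generalizing s M with
  | zero =>
    rcases Nat.eq_zero_or_pos M with rfl | h
    · simpa using dyadicSquareSum_nonneg f 0 s
    · have : M = 2 ^ 0 := by simp at hM ⊢; omega
      subst this
      simp [dyadicSquareSum]
  | succ J ih =>
    have h0 := dyadicSquareSum_nonneg f J s
    have h1 := dyadicSquareSum_nonneg f J (s + 2 ^ J)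
    have hge : dyadicSquareSum f J s + dyadicSquareSum f J (s + 2 ^ J)
        ≤ dyadicSquareSum f (J + 1) s := by
      rw [dyadicSquareSum]
      have := sq_nonneg ‖∑ n ∈ Finset.Ico s (s + 2 ^ (J + 1)), f n‖
      linarith
    push_cast
    rcases le_total M (2 ^ J) with h | h
    · refine (ih s M h).trans ?_
      have hJ : (0 : ℝ) ≤ J := by positivity
      nlinarith
    · obtain ⟨t, rfl⟩ := Nat.exists_eq_add_of_le h
      have ht : t ≤ 2 ^ J := by rw [pow_succ] at hM; omega
      have hsplit : ∑ n ∈ Finset.Ico s (s + (2 ^ J + t)), f n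
          = ∑ n ∈ Finset.Ico s (s + 2 ^ J), f n
            + ∑ n ∈ Finset.Ico (s + 2 ^ J) (s + 2 ^ J + t), f n := by
        rw [← add_assoc, Finset.sum_Ico_consecutive _ (by omega) (by omega)]
      have hB := ih (s + 2 ^ J) t ht
      have hA := norm_sq_sum_le_dyadicSquareSum f J s
      rw [hsplit]
      set a := ∑ n ∈ Finset.Ico s (s + 2 ^ J), f n
      set b := ∑ n ∈ Finset.Ico (s + 2 ^ J) (s + 2 ^ J + t), f n
      have hJ : (0 : ℝ) < (J : ℝ) + 1 := by positivity
      -- weighting `‖b‖ ^ 2` by `1 / (J + 1)` turns the factor `J + 1` into `J + 2`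
      calc ‖a + b‖ ^ 2 ≤ (‖a‖ + ‖b‖) ^ 2 := by gcongr; exact norm_add_le _ _
        _ ≤ ((J : ℝ) + 1 + 1) * (‖a‖ ^ 2 + ‖b‖ ^ 2 / ((J : ℝ) + 1)) := add_sq_le_mul_add_div hJ
        _ ≤ ((J : ℝ) + 1 + 1) * dyadicSquareSum f (J + 1) s := by
          gcongr
          refine le_trans ?_ hge
          gcongr
          rw [div_le_iff₀ hJ]
          linarith

section SecondMoment

variable {Ω : Type*} [MeasurableSpace Ω] {P : Measure Ω}

theorem integrable_dyadicSquareSum {Y : ℕ → Ω → ℂ}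
    (hint : ∀ I : Finset ℕ, Integrable (fun ω => ‖∑ n ∈ I, Y n ω‖ ^ 2) P) (J s : ℕ) :
    Integrable (fun ω => dyadicSquareSum (fun n => Y n ω) J s) P := by
  induction J generalizing s with
  | zero => simp only [dyadicSquareSum]; exact hint _
  | succ J ih =>
    simp only [dyadicSquareSum]
    exact (hint _).add ((ih s).add (ih (s + 2 ^ J)))

theorem integral_dyadicSquareSum_le {Y : ℕ → Ω → ℂ}
    (hint : ∀ I : Finset ℕ, Integrable (fun ω => ‖∑ n ∈ I, Y n ω‖ ^ 2) P) {B : ℝ} {H : ℕ}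
    (hB : ∀ s L : ℕ, s + L ≤ H → ∫ ω, ‖∑ n ∈ Finset.Ico s (s + L), Y n ω‖ ^ 2 ∂P ≤ B * L)
    (J s : ℕ) (hs : s + 2 ^ J ≤ H) :
    ∫ ω, dyadicSquareSum (fun n => Y n ω) J s ∂P ≤ (J + 1) * (B * 2 ^ J) := by
  induction J generalizing s with
  | zero =>
    simp only [dyadicSquareSum]
    simpa using hB s (2 ^ 0) hs
  | succ J ih =>
    have hpow : 2 ^ (J + 1) = 2 ^ J + 2 ^ J := by rw [pow_succ]; omega
    have hs₂ : s + 2 ^ J + 2 ^ J ≤ H := by omega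
    have hs₁ : s + 2 ^ J ≤ H := (Nat.le_add_right _ _).trans hs₂
    simp only [dyadicSquareSum]
    have hadd : Integrable (fun ω => dyadicSquareSum (fun n => Y n ω) J s
        + dyadicSquareSum (fun n => Y n ω) J (s + 2 ^ J)) P :=
      (integrable_dyadicSquareSum hint J s).add (integrable_dyadicSquareSum hint J (s + 2 ^ J))
    rw [integral_add (hint _) hadd, integral_add (integrable_dyadicSquareSum hint J s)
        (integrable_dyadicSquareSum hint J (s + 2 ^ J))]
    have h1 := hB s (2 ^ (J + 1)) hs
    have h2 := ih s hs₁
    have h3 := ih (s + 2 ^ J) hs₂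
    have hpow' : (2 : ℝ) ^ (J + 1) = 2 * 2 ^ J := pow_succ' 2 J
    push_cast at h1 ⊢
    rw [hpow'] at h1 ⊢
    linarith

/-- The Borel–Cantelli step, in the form given by Markov's inequality for a sum. -/
theorem ae_exists_forall_le_of_summable_integral {Z : ℕ → Ω → ℝ} {b : ℕ → ℝ}
    (hint : ∀ J, Integrable (Z J) P) (hZ : ∀ J ω, 0 ≤ Z J ω) (hb : ∀ J, ∫ ω, Z J ω ∂P ≤ b J)
    (hsum : Summable b) : ∀ᵐ ω ∂P, ∃ C : ℝ, ∀ J, Z J ω ≤ C := by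
  have hmeas : ∀ J, AEMeasurable (fun ω => ENNReal.ofReal (Z J ω)) P :=
    fun J => (hint J).aestronglyMeasurable.aemeasurable.ennreal_ofReal
  have hb0 : ∀ J, 0 ≤ b J := fun J => (integral_nonneg (hZ J)).trans (hb J)
  have hfin : ∫⁻ ω, ∑' J, ENNReal.ofReal (Z J ω) ∂P ≠ ∞ := by
    rw [lintegral_tsum hmeas]
    refine ne_top_of_le_ne_top (b := ENNReal.ofReal (∑' J, b J)) ENNReal.ofReal_ne_top ?_
    rw [ENNReal.ofReal_tsum_of_nonneg hb0 hsum]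
    refine ENNReal.tsum_le_tsum fun J => ?_
    rw [← ofReal_integral_eq_lintegral_ofReal (hint J) (Eventually.of_forall (hZ J))]
    exact ENNReal.ofReal_le_ofReal (hb J)
  filter_upwards [ae_lt_top' (AEMeasurable.tsum hmeas) hfin] with ω hω
  refine ⟨(∑' J, ENNReal.ofReal (Z J ω)).toReal, fun J => ?_⟩
  rw [← ENNReal.ofReal_le_iff_le_toReal hω.ne]
  exact ENNReal.le_tsum J

/-- Square-root cancellation on average over every interval, up to `H ^ ε`, gives almost sure
square-root cancellation in the partial sums. -/
theorem ae_exists_norm_sum_le_rpow {Y : ℕ → Ω → ℂ} (k : ℕ)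
    (hint : ∀ I : Finset ℕ, Integrable (fun ω => ‖∑ n ∈ I, Y n ω‖ ^ 2) P)
    (hY : ∀ ε : ℝ, 0 < ε → ∃ K : ℝ, 0 < K ∧ ∀ s L H : ℕ, s + L + k ≤ H →
      ∫ ω, ‖∑ n ∈ Finset.Ico s (s + L), Y n ω‖ ^ 2 ∂P ≤ K * (H : ℝ) ^ ε * L)
    {ε : ℝ} (hε : 0 < ε) :
    ∀ᵐ ω ∂P, ∃ C : ℝ, ∀ N : ℕ, 0 < N →
      ‖∑ n ∈ Finset.Icc 1 N, Y n ω‖ ≤ C * (N : ℝ) ^ ((1 / 2 : ℝ) + ε) := by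
  obtain ⟨K, hK, hYK⟩ := hY ε hε
  set ρ : ℝ := 2 ^ (-ε) with hρ
  have hρ0 : 0 < ρ := by positivity
  have hρ1 : ρ < 1 := Real.rpow_lt_one_of_one_lt_of_neg (by norm_num) (by linarith)
  have hsum : Summable fun J : ℕ => K * ((k : ℝ) + 2) ^ ε * (((J : ℝ) + 1) ^ 2 * ρ ^ J) := by
    refine Summable.mul_left _ ?_
    have h := summable_pow_mul_geometric_of_norm_lt_one (R := ℝ) 2 (r := ρ)
      (by rwa [Real.norm_of_nonneg hρ0.le])
    have h' := ((summable_nat_add_iff 1).2 h).mul_left ρ⁻¹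
    refine h'.congr fun J => ?_
    push_cast
    rw [pow_succ ρ J]
    field_simp
  -- the weights absorb both the factor `J + 1` of the maximal inequality and the target size
  set w : ℕ → ℝ := fun J => ((J : ℝ) + 1) * (2 : ℝ) ^ (-((1 + 2 * ε) * J)) with hw
  have hw0 : ∀ J, 0 < w J := fun J => by positivity
  have hbound : ∀ J : ℕ, ∫ ω, w J * dyadicSquareSum (fun n => Y n ω) J 1 ∂P
      ≤ K * ((k : ℝ) + 2) ^ ε * (((J : ℝ) + 1) ^ 2 * ρ ^ J) := by
    intro J
    rw [integral_const_mul]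
    have h1 := integral_dyadicSquareSum_le hint (B := K * (((1 + 2 ^ J + k : ℕ)) : ℝ) ^ ε)
      (H := 1 + 2 ^ J) (fun s L h => hYK s L (1 + 2 ^ J + k) (by omega)) J 1 le_rfl
    have h2 : (((1 + 2 ^ J + k : ℕ)) : ℝ) ^ ε ≤ ((k : ℝ) + 2) ^ ε * (2 : ℝ) ^ (ε * J) := by
      rw [mul_comm ε, Real.rpow_mul (by norm_num), ← Real.mul_rpow (by positivity) (by positivity),
        Real.rpow_natCast]
      refine Real.rpow_le_rpow (by positivity) ?_ hε.le
      push_cast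
      have h : (1 : ℝ) ≤ 2 ^ J := one_le_pow₀ (by norm_num)
      have hk : (0 : ℝ) ≤ k := by positivity
      nlinarith
    calc w J * ∫ ω, dyadicSquareSum (fun n => Y n ω) J 1 ∂P
        ≤ w J * (((J : ℝ) + 1) * (K * (((k : ℝ) + 2) ^ ε * (2 : ℝ) ^ (ε * J)) * 2 ^ J)) := by
          have := (hw0 J).le
          gcongr
          refine h1.trans ?_
          gcongr
      _ = K * ((k : ℝ) + 2) ^ ε * (((J : ℝ) + 1) ^ 2 *
            ((2 : ℝ) ^ (-((1 + 2 * ε) * J)) * (2 : ℝ) ^ (ε * J) * 2 ^ J)) := by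
          simp only [hw]; ring
      _ = K * ((k : ℝ) + 2) ^ ε * (((J : ℝ) + 1) ^ 2 * ρ ^ J) := by
          rw [hρ, ← Real.rpow_natCast (2 ^ (-ε)) J, ← Real.rpow_natCast (2 : ℝ) J,
            ← Real.rpow_mul (by norm_num),
            ← Real.rpow_add (by norm_num), ← Real.rpow_add (by norm_num)]
          congr 3
          ring
  have hae := ae_exists_forall_le_of_summable_integral
    (Z := fun J ω => w J * dyadicSquareSum (fun n => Y n ω) J 1)
    (fun J => (integrable_dyadicSquareSum hint J 1).const_mul _)
    (fun J ω => mul_nonneg (hw0 J).le (dyadicSquareSum_nonneg _ _ _)) hbound hsum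
  filter_upwards [hae] with ω ⟨C, hC⟩
  have hC0 : 0 ≤ C := (mul_nonneg (hw0 0).le (dyadicSquareSum_nonneg _ _ _)).trans (hC 0)
  refine ⟨√(C * 2 ^ (1 + 2 * ε)), fun N hN => ?_⟩
  -- the first dyadic scale that covers `N`
  set J := Nat.clog 2 N with hJ
  have hNJ : N ≤ 2 ^ J := Nat.le_pow_clog (by norm_num) N
  have hJN : (2 : ℝ) ^ J ≤ 2 * N := by
    rcases Nat.lt_or_ge 1 N with h | h
    · have h1 := Nat.pow_pred_clog_lt_self (b := 2) (by norm_num) h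
      have h2 : 0 < J := Nat.clog_pos (by norm_num) h
      have h3 : 2 ^ J = 2 * 2 ^ (J - 1) := by
        rw [← pow_succ', Nat.sub_add_cancel h2]
      have h4 : 2 ^ J ≤ 2 * N := by
        rw [h3]
        exact Nat.mul_le_mul_left 2 h1.le
      exact_mod_cast h4
    · have : N = 1 := by omega
      have hJ0 : J = 0 := by rw [hJ, this]; simp
      rw [hJ0, this]
      norm_num
  have hsq : ‖∑ n ∈ Finset.Icc 1 N, Y n ω‖ ^ 2 ≤ C * (2 : ℝ) ^ ((1 + 2 * ε) * J) := by
    have h1 := norm_sq_sum_le_mul_dyadicSquareSum (fun n => Y n ω) J 1 N hNJ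
    have h2 := hC J
    have hIcc : Finset.Icc 1 N = Finset.Ico 1 (1 + N) := by
      ext; simp only [Finset.mem_Icc, Finset.mem_Ico]; omega
    rw [hIcc]
    refine h1.trans ?_
    rw [← div_le_iff₀ (by positivity), div_eq_mul_inv, ← Real.rpow_neg (by norm_num)]
    calc _ = w J * dyadicSquareSum (fun n => Y n ω) J 1 := by simp only [hw]; ring
      _ ≤ C := h2
  refine abs_le_of_sq_le_sq' ?_ (by positivity) |>.2
  rw [mul_pow, Real.sq_sqrt (by positivity), ← Real.rpow_natCast (_ ^ _) 2,
    ← Real.rpow_mul (by positivity)]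
  calc _ ≤ C * (2 : ℝ) ^ ((1 + 2 * ε) * J) := hsq
    _ = C * ((2 : ℝ) ^ J) ^ (1 + 2 * ε) := by
        rw [mul_comm (1 + 2 * ε), Real.rpow_mul (by norm_num), Real.rpow_natCast]
    _ ≤ C * (2 * N) ^ (1 + 2 * ε) := by gcongr
    _ = _ := by
        rw [Real.mul_rpow (by norm_num) (by positivity), mul_assoc]
        congr 3
        push_cast
        ring

/-- Expanding the square: if the correlation of two bounded variables vanishes unless they have the
same label, the second moment of a sum is at most the number of pairs of indices with equal
labels. -/
theorem integral_norm_sq_sum_le_card [IsProbabilityMeasure P] {Y : ℕ → Ω → ℂ} (c : ℕ → ℕ)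
    (hmeas : ∀ n, AEStronglyMeasurable (Y n) P) (hnorm : ∀ n ω, ‖Y n ω‖ ≤ 1)
    (horth : ∀ n n', c n ≠ c n' → ∫ ω, Y n ω * (starRingEnd ℂ) (Y n' ω) ∂P = 0) (I : Finset ℕ) :
    ∫ ω, ‖∑ n ∈ I, Y n ω‖ ^ 2 ∂P
      ≤ (((I ×ˢ I).filter fun z : ℕ × ℕ => c z.1 = c z.2).card : ℝ) := by
  have hle : ∀ n n' ω, ‖Y n ω * (starRingEnd ℂ) (Y n' ω)‖ ≤ 1 := fun n n' ω => by
    rw [norm_mul, RCLike.norm_conj]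
    exact mul_le_one₀ (hnorm n ω) (norm_nonneg _) (hnorm n' ω)
  have hint : ∀ n n', Integrable (fun ω => Y n ω * (starRingEnd ℂ) (Y n' ω)) P := fun n n' =>
    Integrable.of_bound ((hmeas n).mul
      (Complex.continuous_conj.comp_aestronglyMeasurable (hmeas n'))) 1
      (Eventually.of_forall (hle n n'))
  have hexp : ((∫ ω, ‖∑ n ∈ I, Y n ω‖ ^ 2 ∂P : ℝ) : ℂ)
      = ∑ z ∈ I ×ˢ I, ∫ ω, Y z.1 ω * (starRingEnd ℂ) (Y z.2 ω) ∂P := by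
    rw [← integral_complex_ofReal, ← integral_finsetSum _ fun z _ => hint z.1 z.2]
    refine integral_congr_ae (Eventually.of_forall fun ω => ?_)
    simp only
    rw [Complex.ofReal_pow, ← Complex.mul_conj', map_sum, Finset.sum_mul_sum,
      Finset.sum_product]
  have hnn : 0 ≤ ∫ ω, ‖∑ n ∈ I, Y n ω‖ ^ 2 ∂P := integral_nonneg fun ω => by positivity
  calc ∫ ω, ‖∑ n ∈ I, Y n ω‖ ^ 2 ∂P = ‖((∫ ω, ‖∑ n ∈ I, Y n ω‖ ^ 2 ∂P : ℝ) : ℂ)‖ := by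
        rw [Complex.norm_real, Real.norm_of_nonneg hnn]
    _ ≤ ∑ z ∈ I ×ˢ I, ‖∫ ω, Y z.1 ω * (starRingEnd ℂ) (Y z.2 ω) ∂P‖ := by
        rw [hexp]; exact norm_sum_le _ _
    _ ≤ ∑ z ∈ I ×ˢ I, if c z.1 = c z.2 then (1 : ℝ) else 0 := by
        refine Finset.sum_le_sum fun z _ => ?_
        split_ifs with h
        · simpa using norm_integral_le_of_norm_le_const (μ := P)
            (Eventually.of_forall (hle z.1 z.2))
        · rw [horth _ _ h, norm_zero]
    _ = _ := by rw [Finset.sum_boole]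

end SecondMoment

/-! ### Roots of unity and their characters -/

theorem ncard_unityRoots {q : ℕ} (hq : 0 < q) : (unityRoots q).ncard = q := by
  have himg : (fun z : Circle => (z : ℂ)) '' unityRoots q
      = (Polynomial.nthRootsFinset q (1 : ℂ) : Set ℂ) := by
    ext w
    simp only [Set.mem_image, Finset.mem_coe, Polynomial.mem_nthRootsFinset hq]
    constructor
    · rintro ⟨z, hz, rfl⟩
      have hz' : z ^ q = 1 := hz
      rw [← Circle.coe_pow, hz', Circle.coe_one]
    · intro hw
      obtain ⟨z, rfl⟩ : ∃ z : Circle, (z : ℂ) = w :=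
        ⟨⟨w, mem_sphere_zero_iff_norm.2 (Complex.norm_eq_one_of_pow_eq_one hw hq.ne')⟩, rfl⟩
      exact ⟨z, Circle.ext (by rw [Circle.coe_pow, hw, Circle.coe_one]), rfl⟩
  rw [← Set.ncard_image_of_injective (unityRoots q) Circle.coe_injective, himg,
    Set.ncard_coe_finset, (Complex.isPrimitiveRoot_exp q hq.ne').card_nthRootsFinset]

theorem ncard_unityRootsPow {q : ℕ} (hq : 0 < q) (k : ℕ) :
    (unityRootsPow q k).ncard = q ^ k := by
  have h : unityRootsPow q k
      = (Fintype.piFinset fun _ : Fin k => (unityRoots_finite hq).toFinset :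
          Set (Fin k → Circle)) := by
    ext z
    simp [unityRootsPow]
  rw [h, Set.ncard_coe_finset, Fintype.card_piFinset]
  simp [← Set.ncard_eq_toFinset_card _ (unityRoots_finite hq), ncard_unityRoots hq]

theorem integral_uniformOn {α E : Type*} [MeasurableSpace α] [MeasurableSingletonClass α]
    [NormedAddCommGroup E] [NormedSpace ℝ E] [CompleteSpace E] {S : Set α} (hS : S.Finite)
    (f : α → E) :
    ∫ x, f x ∂(uniformOn S) = (S.ncard : ℝ)⁻¹ • ∑ x ∈ hS.toFinset, f x := by
  classical
  obtain ⟨S, rfl⟩ := hS.exists_finset_coe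
  have hfin : IntegrableOn f S Measure.count := by
    rw [← Finset.biUnion_singleton_eq_self (s := S), Finset.coe_biUnion]
    simp [integrableOn_finset_iUnion]
  rw [uniformOn, ProbabilityTheory.cond, integral_smul_measure, setIntegral_finset _ hfin]
  simp [Measure.real]

theorem exists_mem_unityRoots_pow_mul_inv_pow_ne_one {q : ℕ} (hq : 0 < q) {a b : ℕ}
    (hab : a % q ≠ b % q) : ∃ z ∈ unityRoots q, z ^ a * z⁻¹ ^ b ≠ 1 := by
  have hζ : IsPrimitiveRoot (Circle.exp (2 * Real.pi / q)) q := by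
    refine IsPrimitiveRoot.of_map_of_injective (f := Circle.coeHom) ?_ Circle.coe_injective
    have h := Complex.isPrimitiveRoot_exp q hq.ne'
    convert h using 1
    change ((Circle.exp (2 * Real.pi / q) : Circle) : ℂ) = _
    rw [Circle.coe_exp]
    push_cast
    congr 1
    ring
  refine ⟨_, hζ.pow_eq_one, fun h => hab ?_⟩
  rw [inv_pow, mul_inv_eq_one, pow_eq_pow_iff_modEq, ← hζ.eq_orderOf] at h
  exact h

theorem sum_unityRoots_pow_mul_inv_pow_eq_zero {q : ℕ} (hq : 0 < q) {a b : ℕ}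
    (hab : a % q ≠ b % q) :
    ∑ z ∈ (unityRoots_finite hq).toFinset, ((z ^ a * z⁻¹ ^ b : Circle) : ℂ) = 0 := by
  -- multiplication by `ζ` permutes the roots of unity and multiplies the sum by `c ≠ 1`
  obtain ⟨ζ, hζ, hne⟩ := exists_mem_unityRoots_pow_mul_inv_pow_ne_one hq hab
  have hζ' : ζ ^ q = 1 := hζ
  set c : ℂ := ((ζ ^ a * ζ⁻¹ ^ b : Circle) : ℂ) with hc
  have hc1 : c ≠ 1 := fun h => hne (Circle.coe_eq_one.1 h)
  have h : ∑ z ∈ (unityRoots_finite hq).toFinset, ((z ^ a * z⁻¹ ^ b : Circle) : ℂ)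
      = c * ∑ z ∈ (unityRoots_finite hq).toFinset, ((z ^ a * z⁻¹ ^ b : Circle) : ℂ) := by
    rw [Finset.mul_sum]
    refine Finset.sum_bij' (fun z _ => ζ⁻¹ * z) (fun z _ => ζ * z) ?_ ?_ ?_ ?_ ?_
    · intro z hz
      have hz' : z ^ q = 1 := by simpa [unityRoots] using hz
      simp [unityRoots, mul_pow, hz', hζ']
    · intro z hz
      have hz' : z ^ q = 1 := by simpa [unityRoots] using hz
      simp [unityRoots, mul_pow, hz', hζ']
    · intro z _; simp
    · intro z _; simp
    · intro z _
      rw [hc, ← Circle.coe_mul]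
      congr 1
      rw [mul_mul_mul_comm, ← mul_pow, ← mul_pow, ← mul_inv, mul_inv_cancel_left]
  have : (1 - c) * ∑ z ∈ (unityRoots_finite hq).toFinset, ((z ^ a * z⁻¹ ^ b : Circle) : ℂ) = 0 := by
    rw [sub_mul, one_mul, ← h, sub_self]
  exact (mul_eq_zero.1 this).resolve_left (sub_ne_zero.2 hc1.symm)

theorem sum_range_coe_pow_eq_ite {q : ℕ} {w : Circle} (hw : w ^ q = 1) [Decidable (w = 1)] :
    ∑ m ∈ Finset.range q, (w : ℂ) ^ m = if w = 1 then (q : ℂ) else 0 := by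
  split_ifs with h
  · simp [h]
  · have hw' : (w : ℂ) ≠ 1 := fun h' => h (Circle.coe_eq_one.1 h')
    rw [geom_sum_eq hw', ← Circle.coe_pow, hw, Circle.coe_one, sub_self, zero_div]

/-- Orthogonality of characters of the group of `k`-tuples of `q`-th roots of unity. -/
theorem sum_piFinset_prod_pow_eq_ite {q k : ℕ} {z t : Fin k → Circle}
    (hz : z ∈ unityRootsPow q k) (ht : t ∈ unityRootsPow q k) [Decidable (z = t)] :
    ∑ m ∈ Fintype.piFinset fun _ : Fin k => Finset.range q,
        ∏ j, ((z j : ℂ) ^ m j * ((t j)⁻¹ : Circle) ^ m j) = if z = t then (q : ℂ) ^ k else 0 := by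
  classical
  have hpow : ∀ j, (z j * (t j)⁻¹) ^ q = 1 := fun j => by
    have h1 : z j ^ q = 1 := hz j
    have h2 : t j ^ q = 1 := ht j
    rw [mul_pow, inv_pow, h1, h2, inv_one, one_mul]
  rw [← Finset.prod_univ_sum (fun _ : Fin k => Finset.range q)
    (fun j e => (z j : ℂ) ^ e * ((t j)⁻¹ : Circle) ^ e)]
  simp only [← mul_pow, ← Circle.coe_mul]
  simp only [sum_range_coe_pow_eq_ite (hpow _), mul_inv_eq_one]
  split_ifs with h
  · simp [h]
  · obtain ⟨j, hj⟩ := Function.ne_iff.1 h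
    exact Finset.prod_eq_zero (Finset.mem_univ j) (if_neg hj)

theorem coe_circle_prod {ι : Type*} (S : Finset ι) (g : ι → Circle) :
    ((∏ i ∈ S, g i : Circle) : ℂ) = ∏ i ∈ S, (g i : ℂ) :=
  map_prod Circle.coeHom g S

theorem continuous_coe_circle : Continuous fun z : Circle => (z : ℂ) := continuous_induced_dom

/-! ### Completely multiplicative functions -/

theorem exists_finset_primes_dvd {n : ℕ} (hn : n ≠ 0) :
    ∃ S : Finset Nat.Primes, ∀ p : Nat.Primes, (p : ℕ) ∣ n → p ∈ S :=
  ⟨n.primeFactors.subtype Nat.Prime, fun p hp =>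
    Finset.mem_subtype.2 (Nat.mem_primeFactors.2 ⟨p.2, hp, hn⟩)⟩

namespace IsCompletelyMultiplicative

variable {f : ℕ → Circle}

theorem map_pow (hf : IsCompletelyMultiplicative f) {n : ℕ} (hn : 0 < n) (e : ℕ) :
    f (n ^ e) = f n ^ e := by
  induction e with
  | zero => simpa using hf.map_one
  | succ e ih => rw [pow_succ, hf.map_mul _ _ (by positivity) hn, ih, pow_succ]

theorem map_prod (hf : IsCompletelyMultiplicative f) {ι : Type*} (S : Finset ι) (a : ι → ℕ)
    (ha : ∀ i ∈ S, 0 < a i) :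
    f (∏ i ∈ S, a i) = ∏ i ∈ S, f (a i) := by
  classical
  induction S using Finset.induction_on with
  | empty => simpa using hf.map_one
  | insert i S hi ih =>
    rw [Finset.prod_insert hi, Finset.prod_insert hi, hf.map_mul _ _ (ha i (by simp))
      (Finset.prod_pos fun j hj => ha j (by simp [hj])), ih fun j hj => ha j (by simp [hj])]

theorem map_shiftedProduct (hf : IsCompletelyMultiplicative f) {k : ℕ} (m : Fin k → ℕ) (n : ℕ) :
    f (shiftedProduct m n) = ∏ j : Fin k, f (n + ((j : ℕ) + 1)) ^ m j := by
  rw [shiftedProduct, hf.map_prod _ _ fun j _ => by positivity]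
  exact Finset.prod_congr rfl fun j _ => hf.map_pow (by omega) _

theorem map_eq_prod_primes (hf : IsCompletelyMultiplicative f) {n : ℕ} (hn : n ≠ 0)
    {S : Finset Nat.Primes} (hS : ∀ p : Nat.Primes, (p : ℕ) ∣ n → p ∈ S) :
    f n = ∏ p ∈ S, f p ^ n.factorization p := by
  have h : n = ∏ p ∈ S, (p : ℕ) ^ n.factorization p := by
    conv_lhs => rw [← Nat.prod_factorization_pow_eq_self hn]
    rw [Finsupp.prod, Nat.support_factorization]
    symm
    refine Finset.prod_bij_ne_one (fun p _ _ => (p : ℕ)) ?_ ?_ ?_ ?_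
    · intro p _ hp
      rw [Nat.mem_primeFactors]
      refine ⟨p.2, ?_, hn⟩
      by_contra hnd
      exact hp (by rw [Nat.factorization_eq_zero_of_not_dvd hnd, pow_zero])
    · intro p _ _ p' _ _ h
      exact Subtype.ext h
    · intro p hp hne
      rw [Nat.mem_primeFactors] at hp
      exact ⟨⟨p, hp.1⟩, hS ⟨p, hp.1⟩ hp.2.1, hne, rfl⟩
    · intros; rfl
  conv_lhs => rw [h]
  rw [hf.map_prod _ _ fun p _ => pow_pos p.2.pos _]
  exact Finset.prod_congr rfl fun p _ => hf.map_pow p.2.pos _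

end IsCompletelyMultiplicative

/-! ### From character sums to patterns and to weak convergence -/

section Deterministic

variable {q k : ℕ} {f : ℕ → Circle}

/-- The Fourier expansion of the number of occurrences of a pattern `t`. -/
theorem patternProportion_eq_sum (hq : 0 < q) (hf : IsCompletelyMultiplicative f)
    (hfq : ∀ n, 0 < n → f n ∈ unityRoots q) {t : Fin k → Circle} (ht : t ∈ unityRootsPow q k)
    (N : ℕ) :
    (patternProportion f t N : ℂ) = ((q : ℂ) ^ k)⁻¹ *
      ∑ m ∈ Fintype.piFinset fun _ : Fin k => Finset.range q,
        (∏ j, (((t j)⁻¹ : Circle) : ℂ) ^ m j) *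
          ((∑ n ∈ Finset.Icc 1 N, (f (shiftedProduct m n) : ℂ)) / N) := by
  classical
  have hq' : ((q : ℂ) ^ k) ≠ 0 := pow_ne_zero _ (by exact_mod_cast hq.ne')
  have hcons : ∀ n, consecutiveValues f k n ∈ unityRootsPow q k := fun n j => hfq _ (by omega)
  have hcard : ((((Finset.Icc 1 N).filter fun n => consecutiveValues f k n = t).card : ℕ) : ℂ)
      = ((q : ℂ) ^ k)⁻¹ * ∑ n ∈ Finset.Icc 1 N,
        ∑ m ∈ Fintype.piFinset fun _ : Fin k => Finset.range q,
          (∏ j, (((t j)⁻¹ : Circle) : ℂ) ^ m j) * (f (shiftedProduct m n) : ℂ) := by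
    rw [Finset.mul_sum, ← Finset.sum_boole]
    refine Finset.sum_congr rfl fun n _ => ?_
    have h := sum_piFinset_prod_pow_eq_ite (hcons n) ht
    have h' : ∑ m ∈ Fintype.piFinset fun _ : Fin k => Finset.range q,
        (∏ j, (((t j)⁻¹ : Circle) : ℂ) ^ m j) * (f (shiftedProduct m n) : ℂ)
        = if consecutiveValues f k n = t then (q : ℂ) ^ k else 0 := by
      rw [← h]
      refine Finset.sum_congr rfl fun m _ => ?_
      rw [hf.map_shiftedProduct, Finset.prod_mul_distrib, mul_comm]
      congr 1
      rw [coe_circle_prod]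
      rfl
    rw [h']
    split_ifs
    · rw [inv_mul_cancel₀ hq']
    · rw [mul_zero]
  rw [patternProportion, Complex.ofReal_div, Complex.ofReal_natCast, Complex.ofReal_natCast]
  convert congrArg (fun x : ℂ => x / N) hcard using 1
  rw [Finset.sum_comm, mul_div_assoc, Finset.sum_div]
  congr 1
  refine Finset.sum_congr rfl fun m _ => ?_
  rw [← Finset.mul_sum, mul_div_assoc]

theorem patternProportion_sub_isBigO (hq : 0 < q) (hf : IsCompletelyMultiplicative f)
    (hfq : ∀ n, 0 < n → f n ∈ unityRoots q) {ε : ℝ}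
    (hbound : ∀ m : Fin k → ℕ, (∃ i, ¬ q ∣ m i) → ∃ C : ℝ, ∀ N : ℕ, 0 < N →
      ‖∑ n ∈ Finset.Icc 1 N, (f (shiftedProduct m n) : ℂ)‖ ≤ C * (N : ℝ) ^ ((1 / 2 : ℝ) + ε))
    {t : Fin k → Circle} (ht : t ∈ unityRootsPow q k) :
    (fun N : ℕ => patternProportion f t N - ((q : ℝ) ^ k)⁻¹)
      =O[atTop] fun N : ℕ => (N : ℝ) ^ (-(1 / 2 : ℝ) + ε) := by
  classical
  set S := Fintype.piFinset fun _ : Fin k => Finset.range q with hS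
  have h0S : (0 : Fin k → ℕ) ∈ S := by simp [hS, hq]
  have hne : ∀ m ∈ S.erase 0, ∃ i, ¬ q ∣ m i := by
    intro m hm
    rw [Finset.mem_erase, hS, Fintype.mem_piFinset] at hm
    obtain ⟨i, hi⟩ := Function.ne_iff.1 hm.1
    refine ⟨i, fun hdvd => hi (Nat.eq_zero_of_dvd_of_lt hdvd (Finset.mem_range.1 (hm.2 i)))⟩
  have hterm : ∀ m ∈ S.erase 0,
      (fun N : ℕ => (∏ j, (((t j)⁻¹ : Circle) : ℂ) ^ m j) *
          ((∑ n ∈ Finset.Icc 1 N, (f (shiftedProduct m n) : ℂ)) / N))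
        =O[atTop] fun N : ℕ => (N : ℝ) ^ (-(1 / 2 : ℝ) + ε) := by
    intro m hm
    obtain ⟨C, hC⟩ := hbound m (hne m hm)
    refine IsBigO.const_mul_left (IsBigO.of_bound C ?_) _
    filter_upwards [eventually_gt_atTop 0] with N hN
    have hN' : (0 : ℝ) < N := by exact_mod_cast hN
    rw [norm_div, Complex.norm_natCast, div_le_iff₀ hN',
      Real.norm_of_nonneg (Real.rpow_nonneg hN'.le _), mul_assoc]
    have hpow : (N : ℝ) ^ (-(1 / 2 : ℝ) + ε) * N = (N : ℝ) ^ ((1 / 2 : ℝ) + ε) := by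
      rw [← Real.rpow_add_one hN'.ne']
      congr 1
      ring
    rw [hpow]
    exact hC N hN
  have hsum := (IsBigO.sum hterm).const_mul_left ((q : ℂ) ^ k)⁻¹
  refine IsBigO.of_norm_left (hsum.norm_left.congr' ?_ EventuallyEq.rfl)
  filter_upwards [eventually_gt_atTop 0] with N hN
  have hN' : (N : ℂ) ≠ 0 := by exact_mod_cast hN.ne'
  rw [← Complex.norm_real (_ - _)]
  congr 1
  push_cast
  rw [patternProportion_eq_sum hq hf hfq ht, ← hS, ← Finset.add_sum_erase S _ h0S, mul_add]
  have hone : ∀ n, shiftedProduct (0 : Fin k → ℕ) n = 1 := fun n => by simp [shiftedProduct]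
  simp [hone, hf.map_one, hN']

theorem tendsto_patternProportion_of_isBigO {t : Fin k → Circle} {c : ℝ}
    (h : (fun N : ℕ => patternProportion f t N - c)
      =O[atTop] fun N : ℕ => (N : ℝ) ^ (-(1 / 2 : ℝ) + 1 / 4)) :
    Tendsto (fun N : ℕ => patternProportion f t N) atTop (𝓝 c) := by
  have h1 : Tendsto (fun N : ℕ => (N : ℝ) ^ (-(1 / 2 : ℝ) + 1 / 4)) atTop (𝓝 0) := by
    have := (tendsto_rpow_neg_atTop (y := 1 / 4) (by norm_num)).comp
      (tendsto_natCast_atTop_atTop (R := ℝ))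
    refine this.congr fun N => ?_
    simp only [Function.comp]
    norm_num
  simpa using (h.trans_tendsto h1).add_const c

theorem integral_empiricalMeasure (hq : 0 < q) (hfq : ∀ n, 0 < n → f n ∈ unityRoots q) (N : ℕ+)
    (g : (Fin k → Circle) → ℝ) (hg : StronglyMeasurable g) :
    ∫ z, g z ∂(empiricalMeasure f k N : Measure (Fin k → Circle))
      = ∑ t ∈ (unityRootsPow_finite hq k).toFinset, patternProportion f t N * g t := by
  classical
  have hcons : ∀ n, consecutiveValues f k n ∈ (unityRootsPow_finite hq k).toFinset := fun n => by
    rw [Set.Finite.mem_toFinset]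
    exact fun j => hfq _ (by omega)
  change ∫ z, g z ∂((((N : ℕ) : ℝ≥0∞))⁻¹ •
    ∑ n ∈ Finset.Icc 1 (N : ℕ), Measure.dirac (consecutiveValues f k n)) = _
  rw [integral_smul_measure, integral_finsetSum_measure fun n _ => integrable_dirac' hg (by simp)]
  have hsplit : ∀ n, g (consecutiveValues f k n)
      = ∑ t ∈ (unityRootsPow_finite hq k).toFinset,
          if consecutiveValues f k n = t then g t else 0 := fun n => by
    rw [Finset.sum_ite_eq, if_pos (hcons n)]
  simp only [integral_dirac' _ _ hg, hsplit]
  rw [Finset.sum_comm, Finset.smul_sum]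
  refine Finset.sum_congr rfl fun t _ => ?_
  rw [patternProportion, ← Finset.sum_filter, Finset.sum_const, nsmul_eq_mul]
  simp only [ENNReal.toReal_inv, ENNReal.toReal_natCast, smul_eq_mul]
  ring_nf

theorem tendsto_empiricalMeasure (hq : 0 < q) (hfq : ∀ n, 0 < n → f n ∈ unityRoots q)
    (h : ∀ t ∈ unityRootsPow q k,
      Tendsto (fun N : ℕ => patternProportion f t N) atTop (𝓝 ((q : ℝ) ^ k)⁻¹)) :
    Tendsto (fun N : ℕ+ => empiricalMeasure f k N) atTop (𝓝 (uniformRootsMeasure q hq k)) := by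
  rw [ProbabilityMeasure.tendsto_iff_forall_integral_tendsto]
  intro g
  have hlim : ∫ z, g z ∂(uniformRootsMeasure q hq k : Measure (Fin k → Circle))
      = ∑ t ∈ (unityRootsPow_finite hq k).toFinset, ((q : ℝ) ^ k)⁻¹ * g t := by
    change ∫ z, g z ∂(uniformOn (unityRootsPow q k)) = _
    rw [integral_uniformOn (unityRootsPow_finite hq k), ncard_unityRootsPow hq, smul_eq_mul,
      Finset.mul_sum]
    push_cast
    rfl
  rw [hlim]
  simp only [integral_empiricalMeasure hq hfq _ _ g.continuous.stronglyMeasurable]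
  refine tendsto_finsetSum _ fun t ht => ?_
  rw [Set.Finite.mem_toFinset] at ht
  exact ((h t ht).comp tendsto_PNat_val_atTop_atTop).mul_const _

end Deterministic

/-! ### Random completely multiplicative functions -/

section Random

variable {Ω : Type*} [MeasurableSpace Ω] {P : Measure Ω} {q : ℕ} {X : ℕ → Ω → Circle}

theorem aemeasurable_of_isCompletelyMultiplicative
    (hmult : ∀ ω, IsCompletelyMultiplicative fun n => X n ω)
    (hmeas : ∀ p : Nat.Primes, AEMeasurable (X p) P) {n : ℕ} (hn : n ≠ 0) :
    AEMeasurable (X n) P := by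
  obtain ⟨S, hS⟩ := exists_finset_primes_dvd hn
  have h : X n = fun ω => ∏ p ∈ S, X p ω ^ n.factorization p :=
    funext fun ω => (hmult ω).map_eq_prod_primes hn hS
  rw [h]
  exact Finset.aemeasurable_fun_prod _ fun p _ => (hmeas p).pow_const _

theorem ae_forall_mem_unityRoots (hq : 0 < q)
    (hmult : ∀ ω, IsCompletelyMultiplicative fun n => X n ω)
    (hunif : ∀ p : Nat.Primes, HasLaw (X p) (uniformOn (unityRoots q)) P) :
    ∀ᵐ ω ∂P, ∀ n, 0 < n → X n ω ∈ unityRoots q := by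
  have hp : ∀ᵐ ω ∂P, ∀ p : Nat.Primes, X p ω ∈ unityRoots q := by
    rw [ae_all_iff]
    intro p
    refine ((hunif p).ae_iff (p := fun z => z ∈ unityRoots q)
      (measurable_mem.2 (unityRoots_finite hq).measurableSet)).2 ?_
    exact ae_cond_mem (unityRoots_finite hq).measurableSet
  filter_upwards [hp] with ω hω n hn
  obtain ⟨S, hS⟩ := exists_finset_primes_dvd hn.ne'
  have h : X n ω = ∏ p ∈ S, X p ω ^ n.factorization p := (hmult ω).map_eq_prod_primes hn.ne' hS
  have hpow : (X n ω) ^ q = 1 := by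
    rw [h, ← Finset.prod_pow]
    refine Finset.prod_eq_one fun p _ => ?_
    have h1 : X p ω ^ q = 1 := hω p
    rw [← pow_mul, mul_comm, pow_mul, h1, one_pow]
  exact hpow

/-- The variables `X_M` and `X_{M'}` are orthogonal unless `M / M'` is a `q`-th power. -/
theorem integral_mul_conj_eq_zero (hq : 0 < q)
    (hmult : ∀ ω, IsCompletelyMultiplicative fun n => X n ω)
    (hindep : iIndepFun (fun p : Nat.Primes => X p) P)
    (hunif : ∀ p : Nat.Primes, HasLaw (X p) (uniformOn (unityRoots q)) P)
    {M M' : ℕ} (hM : M ≠ 0) (hM' : M' ≠ 0) (hne : powerFreePart q M ≠ powerFreePart q M') :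
    ∫ ω, (X M ω : ℂ) * (starRingEnd ℂ) (X M' ω : ℂ) ∂P = 0 := by
  -- the integral factors over the primes, and the factor at `p₀` vanishes
  rw [Ne, powerFreePart_eq_iff, not_forall] at hne
  obtain ⟨p₀, hp₀⟩ := hne
  have hprime : p₀.Prime := by
    by_contra h
    simp [Nat.factorization_eq_zero_of_not_prime _ h] at hp₀
  obtain ⟨S, hS⟩ := exists_finset_primes_dvd (mul_ne_zero (mul_ne_zero hM hM') hprime.ne_zero)
  have hSM : ∀ p : Nat.Primes, (p : ℕ) ∣ M → p ∈ S := fun p hp =>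
    hS p ((hp.mul_right _).mul_right _)
  have hSM' : ∀ p : Nat.Primes, (p : ℕ) ∣ M' → p ∈ S := fun p hp =>
    hS p ((hp.mul_left _).mul_right _)
  have hSp₀ : (⟨p₀, hprime⟩ : Nat.Primes) ∈ S := hS _ (dvd_mul_left _ _)
  let g : S → Circle → ℂ := fun p z =>
    ((z ^ M.factorization p * z⁻¹ ^ M'.factorization p : Circle) : ℂ)
  have hg : ∀ p, Continuous (g p) := fun p => by
    dsimp only [g]
    exact continuous_coe_circle.comp ((continuous_pow _).mul (continuous_inv.pow _))
  have hexp : ∀ ω, (X M ω : ℂ) * (starRingEnd ℂ) (X M' ω : ℂ) = ∏ p : S, g p (X p ω) := by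
    intro ω
    rw [← Circle.coe_inv_eq_conj, ← Circle.coe_mul, (hmult ω).map_eq_prod_primes hM hSM,
      (hmult ω).map_eq_prod_primes hM' hSM', ← Finset.prod_inv_distrib, ← Finset.prod_mul_distrib,
      ← Finset.prod_coe_sort S, coe_circle_prod]
    refine Finset.prod_congr rfl fun p _ => ?_
    simp only [g, inv_pow]
  simp only [hexp]
  have hindepS := hindep.precomp (g := fun p : S => (p : Nat.Primes)) Subtype.val_injective
  rw [hindepS.integral_fun_prod_comp (fun p => (hunif p).aemeasurable)
    fun p => (hg p).aestronglyMeasurable]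
  refine Finset.prod_eq_zero (Finset.mem_univ ⟨⟨p₀, hprime⟩, hSp₀⟩) ?_
  have h := (hunif ⟨p₀, hprime⟩).integral_comp
    (hg ⟨⟨p₀, hprime⟩, hSp₀⟩).aestronglyMeasurable
  refine h.trans ?_
  rw [integral_uniformOn (unityRoots_finite hq), sum_unityRoots_pow_mul_inv_pow_eq_zero hq hp₀,
    smul_zero]

/-- Almost surely, the partial sums of every nontrivial character of `(X_{n+1}, …, X_{n+k})` have
square-root cancellation. -/
theorem ae_exists_norm_sum_shiftedProduct_le [IsProbabilityMeasure P] (hq : 0 < q)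
    (hmult : ∀ ω, IsCompletelyMultiplicative fun n => X n ω)
    (hindep : iIndepFun (fun p : Nat.Primes => X p) P)
    (hunif : ∀ p : Nat.Primes, HasLaw (X p) (uniformOn (unityRoots q)) P)
    {k : ℕ} (m : Fin k → ℕ) (hm : ∃ i, ¬ q ∣ m i) {ε : ℝ} (hε : 0 < ε) :
    ∀ᵐ ω ∂P, ∃ C : ℝ, ∀ N : ℕ, 0 < N →
      ‖∑ n ∈ Finset.Icc 1 N, (X (shiftedProduct m n) ω : ℂ)‖
        ≤ C * (N : ℝ) ^ ((1 / 2 : ℝ) + ε) := by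
  obtain ⟨i, hi⟩ := hm
  have hmeas : ∀ n, AEStronglyMeasurable (fun ω => (X (shiftedProduct m n) ω : ℂ)) P := fun n =>
    (continuous_coe_circle.measurable.comp_aemeasurable
      (aemeasurable_of_isCompletelyMultiplicative hmult (fun p => (hunif p).aemeasurable)
        (shiftedProduct_ne_zero m n))).aestronglyMeasurable
  have hnorm : ∀ n ω, ‖(X (shiftedProduct m n) ω : ℂ)‖ ≤ 1 := fun n ω => (Circle.norm_coe _).le
  refine ae_exists_norm_sum_le_rpow (Y := fun n ω => (X (shiftedProduct m n) ω : ℂ)) k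
    (fun I => ?_) (fun δ hδ => ?_) hε
  · refine Integrable.of_bound
      ((Finset.aestronglyMeasurable_fun_sum I fun n _ => hmeas n).norm.pow 2) ((I.card : ℝ) ^ 2)
      (Eventually.of_forall fun ω => ?_)
    rw [norm_pow, norm_norm]
    gcongr
    refine (norm_sum_le_of_le I fun n _ => hnorm n ω).trans ?_
    simp
  · obtain ⟨K, hK, hcard⟩ := exists_card_pairs_shiftedProduct_le hq m i hi hδ
    refine ⟨K, hK, fun s L H h => ?_⟩
    refine (integral_norm_sq_sum_le_card (fun n => powerFreePart q (shiftedProduct m n)) hmeas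
      hnorm (fun n n' hne => ?_) _).trans (hcard s L H h)
    exact integral_mul_conj_eq_zero hq hmult hindep hunif (shiftedProduct_ne_zero m n)
      (shiftedProduct_ne_zero m n') hne

end Random

theorem mainTheorem5 {Ω : Type*} [MeasurableSpace Ω] (P : Measure Ω) [IsProbabilityMeasure P]
    (q k : ℕ) (hq : 0 < q) (hk : 0 < k) (X : ℕ → Ω → Circle)
    (hmult : ∀ ω, IsCompletelyMultiplicative fun n => X n ω)
    (hindep : iIndepFun (fun p : Nat.Primes => X p) P)
    (hunif : ∀ p : Nat.Primes, HasLaw (X p) (uniformOn (unityRoots q)) P) :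
    (∀ᵐ ω ∂P,
      Tendsto (fun N : ℕ+ => empiricalMeasure (fun n => X n ω) k N) atTop
        (𝓝 (uniformRootsMeasure q hq k)) ∧
      ∀ t ∈ unityRootsPow q k, ∀ ε : ℝ, 0 < ε →
        (fun N : ℕ => patternProportion (fun n => X n ω) t N - ((q : ℝ) ^ k)⁻¹)
          =O[atTop] fun N : ℕ => (N : ℝ) ^ (-(1 / 2 : ℝ) + ε)) ∧
    (q = 2 → ∀ᵐ ω ∂P, ∀ t : Fin k → Circle, (∀ j, t j = 1 ∨ t j = -1) →
      Tendsto (fun N : ℕ => patternProportion (fun n => X n ω) t N) atTop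
        (𝓝 (((2 : ℝ) ^ k)⁻¹))) := by
  -- the exceptional null sets are indexed by the countably many pairs of an exponent vector `m`
  -- and a bound `ε = 1 / (l + 1)`
  have hchar : ∀ᵐ ω ∂P, ∀ (l : ℕ) (m : Fin k → ℕ), (∃ i, ¬ q ∣ m i) →
      ∃ C : ℝ, ∀ N : ℕ, 0 < N → ‖∑ n ∈ Finset.Icc 1 N, (X (shiftedProduct m n) ω : ℂ)‖
        ≤ C * (N : ℝ) ^ ((1 / 2 : ℝ) + 1 / ((l : ℝ) + 1)) := by
    rw [ae_all_iff]
    intro l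
    rw [ae_all_iff]
    intro m
    by_cases hm : ∃ i, ¬ q ∣ m i
    · filter_upwards [ae_exists_norm_sum_shiftedProduct_le hq hmult hindep hunif m hm
        (Nat.one_div_pos_of_nat (α := ℝ) (n := l))] with ω hω _ using hω
    · exact Eventually.of_forall fun ω h => absurd h hm
  have hbigO : ∀ᵐ ω ∂P, (∀ n, 0 < n → X n ω ∈ unityRoots q) ∧
      ∀ t ∈ unityRootsPow q k, ∀ ε : ℝ, 0 < ε →
        (fun N : ℕ => patternProportion (fun n => X n ω) t N - ((q : ℝ) ^ k)⁻¹)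
          =O[atTop] fun N : ℕ => (N : ℝ) ^ (-(1 / 2 : ℝ) + ε) := by
    filter_upwards [hchar, ae_forall_mem_unityRoots hq hmult hunif] with ω h hroot
    refine ⟨hroot, fun t ht ε hε => ?_⟩
    obtain ⟨l, hl⟩ := exists_nat_one_div_lt hε
    refine (patternProportion_sub_isBigO hq (hmult ω) hroot (h l) ht).trans
      (IsBigO.of_bound 1 ?_)
    filter_upwards [eventually_ge_atTop 1] with N hN
    have hN' : (1 : ℝ) ≤ N := by exact_mod_cast hN
    rw [one_mul, Real.norm_of_nonneg (by positivity), Real.norm_of_nonneg (by positivity)]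
    exact Real.rpow_le_rpow_of_exponent_le hN' (by linarith)
  refine ⟨?_, ?_⟩
  · filter_upwards [hbigO] with ω ⟨hroot, h⟩
    exact ⟨tendsto_empiricalMeasure hq hroot fun t ht =>
      tendsto_patternProportion_of_isBigO (h t ht (1 / 4) (by norm_num)), h⟩
  · rintro rfl
    filter_upwards [hbigO] with ω ⟨_, h⟩ t ht
    have ht' : t ∈ unityRootsPow 2 k := by
      intro j
      have : t j ^ 2 = 1 := by
        rcases ht j with h | h <;> rw [h]
        · exact one_pow 2
        · exact Circle.ext (by simp)
      exact this
    simpa using tendsto_patternProportion_of_isBigO (h t ht' (1 / 4) (by norm_num))
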